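/- A binary code of length $n$ is a linear subspace of $\mathbb{F}_2^n$; two binary codes are isomorphic if one is mapped onto the other by a bijection of the positions. Let $C$ be a binary code that is doubly-even (every codeword has Hamming weight divisible by $4$) and is spanned by its codewords of weight $4$. Then $C$ is isomorphic to a finite (possibly empty) direct sum of codes of the following form, extended by some number $z \ge 0$ of zero positions (positions in which all codewords vanish): (i) the binary simplex code $\mathrm{Sim}_2(3)$ of dimension $3$, generated by the $3\times 7$ matrix whose columns are the nonzero vectors of $\mathbb{F}_2^3$; (ii) the binary first order Reed–Muller code $\mathrm{RM}_2(4)$ of dimension $4$, generated by the $4\times 8$ matrix whose columns are the vectors $(v,1)$ with $v\in\mathbb{F}_2^3$; (iii) for some $k\ge 1$, the $2$-fold repetition of the binary parity check code $\mathrm{PC}_2(k)=\{c\in\mathbb{F}_2^{k+1} : c_1+\dots+c_{k+1}=0\}$, that is, the code $\{(c,c) : c\in \mathrm{PC}_2(k)\}$ of length $2(k+1)$. The number $z$ and, up to the order of the summands, the choice of the codes in the direct sum (including the value of $k$ for each summand of type (iii)) are uniquely determined by $C$. -/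

import Mathlib

/-- A binary linear code whose positions are indexed by `ι` (length `n` means `ι = Fin n`). -/
abbrev BinaryCode (ι : Type) : Type := Submodule (ZMod 2) (ι → ZMod 2)

namespace BinaryCode

/-- `C` is doubly-even: every codeword has (Hamming) weight divisible by `4`. -/
def IsDoublyEven {ι : Type} [Fintype ι] (C : BinaryCode ι) : Prop :=
  ∀ c ∈ C, 4 ∣ hammingNorm c

/-- `C` is the span of its codewords of weight `w`. -/
def IsSpannedByWeight {ι : Type} [Fintype ι] (C : BinaryCode ι) (w : ℕ) : Prop :=
  Submodule.span (ZMod 2) {c | c ∈ C ∧ hammingNorm c = w} = C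

/-- Isomorphism of binary codes: some bijection of the positions carries the codewords of one
code exactly onto the codewords of the other. -/
def Isomorphic {ι κ : Type} (C : BinaryCode ι) (D : BinaryCode κ) : Prop :=
  ∃ σ : κ ≃ ι, ∀ c : ι → ZMod 2, c ∈ C ↔ c ∘ σ ∈ D

/-- The binary simplex code of dimension `k`: the rows `i : Fin k` of the generator matrix whose
columns are the nonzero vectors of `𝔽₂ᵏ`, each taken once. -/
def simplex (k : ℕ) : BinaryCode {v : Fin k → ZMod 2 // v ≠ 0} :=
  Submodule.span (ZMod 2) (Set.range fun (i : Fin k) v => v.1 i)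

/-- The binary first order Reed-Muller code of dimension `m + 1` and length `2 ^ m`: the columns of
the generator matrix are all vectors of `𝔽₂ᵐ`, and an all-one row is added. -/
def firstOrderReedMuller (m : ℕ) : BinaryCode (Fin m → ZMod 2) :=
  Submodule.span (ZMod 2)
    (insert (fun _ => 1) (Set.range fun (i : Fin m) (v : Fin m → ZMod 2) => v i))

/-- The binary parity check code of dimension `k` and length `k + 1`. -/
def parityCheck (k : ℕ) : BinaryCode (Fin (k + 1)) where
  carrier := {c | ∑ i, c i = 0}
  zero_mem' := by simp
  add_mem' := by
    intro c d hc hd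
    simp only [Set.mem_ofPred_eq] at hc hd ⊢
    simp [Finset.sum_add_distrib, hc, hd]
  smul_mem' := by
    intro a c hc
    simp only [Set.mem_ofPred_eq] at hc ⊢
    simp [← Finset.mul_sum, hc]

/-- The `m`-fold repetition of `C`: all words `(c, …, c)` with `c ∈ C`. -/
def repetition {ι : Type} (m : ℕ) (C : BinaryCode ι) : BinaryCode (Fin m × ι) :=
  C.map (LinearMap.funLeft (ZMod 2) (ZMod 2) (Prod.snd : Fin m × ι → ι))

/-- The (outer) direct sum of a family of codes, on the disjoint union of their positions. -/
def directSum {J : Type} {ι : J → Type} (D : (j : J) → BinaryCode (ι j)) :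
    BinaryCode (Σ j, ι j) where
  carrier := {c | ∀ j, (fun i => c ⟨j, i⟩) ∈ D j}
  zero_mem' := fun j => (D j).zero_mem
  add_mem' := fun hc hd j => (D j).add_mem (hc j) (hd j)
  smul_mem' := fun a _ hc j => (D j).smul_mem a (hc j)

/-- The code `C` extended by `z` zero positions. -/
def extendByZeros {ι : Type} (C : BinaryCode ι) (z : ℕ) : BinaryCode (ι ⊕ Fin z) where
  carrier := {c | (fun i => c (Sum.inl i)) ∈ C ∧ ∀ j, c (Sum.inr j) = 0}
  zero_mem' := ⟨C.zero_mem, fun _ => rfl⟩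
  add_mem' := fun hc hd => ⟨C.add_mem hc.1 hd.1, fun j => by simp [hc.2 j, hd.2 j]⟩
  smul_mem' := fun a _ hc => ⟨C.smul_mem a hc.1, fun j => by simp [hc.2 j]⟩

/-- Names for the building blocks: the simplex code of dimension `3`, the first order Reed-Muller
code of dimension `4`, and for each `k ≥ 1` the `2`-fold repetition of the parity check code of
dimension `k`. -/
inductive Block : Type
  | simplexThree : Block
  | reedMullerFour : Block
  | doubledParityCheck (k : ℕ) (hk : 1 ≤ k) : Block

/-- The index type of the positions of a building block. -/
def Block.Pos : Block → Type
  | .simplexThree => {v : Fin 3 → ZMod 2 // v ≠ 0}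
  | .reedMullerFour => Fin 3 → ZMod 2
  | .doubledParityCheck k _ => Fin 2 × Fin (k + 1)

/-- The code that a building block stands for. -/
def Block.code : (b : Block) → BinaryCode b.Pos
  | .simplexThree => simplex 3
  | .reedMullerFour => firstOrderReedMuller 3
  | .doubledParityCheck k _ => repetition 2 (parityCheck k)

/-- The direct sum of the building blocks in the list `L`, extended by `z` zero positions. -/
def blockSum (L : List Block) (z : ℕ) : BinaryCode ((Σ j : Fin L.length, (L.get j).Pos) ⊕ Fin z) :=
  extendByZeros (directSum fun j : Fin L.length => (L.get j).code) z

end BinaryCode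

namespace BinaryCode

/-! Existence. Two words of a doubly-even code meet in an even number of positions, so the code is
self-orthogonal. If the code of a block is embedded in `C`, every word of `C` therefore restricts on
that block to a word of the dual code. For a word of weight 4 this leaves two possibilities
(`Block.absorbs_or_exists_rank_lt`). Either the block absorbs it: it misses the block, or it lies
inside the block and is one of its words. Or a block of larger rank embeds in `C`: a doubled parity
check code gains a pair or, for `k = 2` and `k = 3`, turns into the simplex or Reed–Muller code; the
simplex code turns into the Reed–Muller code; the latter is self-dual and absorbs everything.

The rank is bounded by the length, so starting from the support of one weight-4 word a block is
reached that absorbs all weight-4 words (`exists_absorbing_block`). As these span, `C` is the direct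
sum of the block and a code on the other positions (`split_of_absorbs`), which is again doubly-even
and spanned by weight 4. Induction on the length finishes.

Uniqueness. Linking positions that lie in a common minimal codeword recovers the blocks of a direct
sum; zero positions are linked to nothing. The number of positions linked to a given one, together
with the existence of a repeated column, identifies the block type (`Block.key_injective`). Counting
the positions with each key gives all multiplicities and `z`. -/

instance (b : Block) : Fintype b.Pos := by
  cases b <;> unfold Block.Pos <;> infer_instance

/-! ### Weights, extension by zeros, self-orthogonality -/

theorem zmod_two_eq_zero_or_one (x : ZMod 2) : x = 0 ∨ x = 1 := by
  revert x; decide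

theorem zmod_two_ne_zero_iff {x : ZMod 2} : x ≠ 0 ↔ x = 1 := by
  revert x; decide

/-- The word `w` is the extension of `r` by zeros along `f`. -/
theorem extend_eq_of_comp {ι P : Type} {f : P → ι} (hf : Function.Injective f)
    {r : P → ZMod 2} {w : ι → ZMod 2} (h : ∀ p, w (f p) = r p)
    (h0 : ∀ i, (∀ p, f p ≠ i) → w i = 0) : Function.extend f r 0 = w := by
  funext i
  by_cases hi : ∃ p, f p = i
  · obtain ⟨p, rfl⟩ := hi
    rw [hf.extend_apply, h]
  · rw [Function.extend_apply' _ _ _ hi, Pi.zero_apply, h0 i (by simpa using hi)]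

theorem hammingNorm_eq_comp_add {ι P : Type} [Fintype ι] [DecidableEq ι] [Fintype P] {f : P → ι}
    (hf : Function.Injective f) (t : ι → ZMod 2) :
    hammingNorm t = hammingNorm (fun p => t (f p)) +
      (Finset.univ.filter fun i => t i ≠ 0 ∧ ∀ p, f p ≠ i).card := by
  classical
  unfold hammingNorm
  rw [← Finset.card_map ⟨f, hf⟩, ← Finset.card_union_of_disjoint]
  · congr 1
    ext i
    simp only [Finset.mem_filter, Finset.mem_union, Finset.mem_map, Finset.mem_univ, true_and,
      Function.Embedding.coeFn_mk]
    constructor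
    · intro h
      by_cases hi : ∃ p, f p = i
      · obtain ⟨p, rfl⟩ := hi
        exact Or.inl ⟨p, h, rfl⟩
      · exact Or.inr ⟨h, by simpa using hi⟩
    · rintro (⟨p, h, rfl⟩ | h)
      · exact h
      · exact h.1
  · rw [Finset.disjoint_left]
    simp only [Finset.mem_filter, Finset.mem_map, Finset.mem_univ, true_and,
      Function.Embedding.coeFn_mk]
    rintro i ⟨p, _, rfl⟩ h
    exact h.2 p rfl

theorem hammingNorm_comp_le {ι P : Type} [Fintype ι] [Fintype P] {f : P → ι}
    (hf : Function.Injective f) (t : ι → ZMod 2) :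
    hammingNorm (fun p => t (f p)) ≤ hammingNorm t := by
  classical
  have := hammingNorm_eq_comp_add hf t
  omega

theorem eq_zero_of_hammingNorm_le {ι P : Type} [Fintype ι] [Fintype P] {f : P → ι}
    (hf : Function.Injective f) {t : ι → ZMod 2}
    (h : hammingNorm t ≤ hammingNorm (fun p => t (f p))) (i : ι) (hi : ∀ p, f p ≠ i) : t i = 0 := by
  classical
  have h1 := hammingNorm_eq_comp_add hf t
  have h2 : (Finset.univ.filter fun i => t i ≠ 0 ∧ ∀ p, f p ≠ i) = ∅ := by
    rw [← Finset.card_eq_zero]; omega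
  by_contra h3
  have : i ∈ (Finset.univ.filter fun i => t i ≠ 0 ∧ ∀ p, f p ≠ i) := by
    simp only [Finset.mem_filter, Finset.mem_univ, true_and]; exact ⟨h3, hi⟩
  rw [h2] at this
  simp at this

theorem hammingNorm_extend {ι P : Type} [Fintype ι] [Fintype P] {f : P → ι}
    (hf : Function.Injective f) (c : P → ZMod 2) :
    hammingNorm (Function.extend f c 0 : ι → ZMod 2) = hammingNorm c := by
  classical
  rw [hammingNorm_eq_comp_add hf]
  simp only [hf.extend_apply]
  rw [Nat.add_eq_left, Finset.card_eq_zero, Finset.filter_eq_empty_iff]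
  rintro i _ ⟨h1, h2⟩
  exact h1 (Function.extend_apply' _ _ _ (by simpa using h2))

theorem natCast_hammingNorm {ι : Type} [Fintype ι] (c : ι → ZMod 2) :
    (hammingNorm c : ZMod 2) = ∑ i, c i := by
  unfold hammingNorm
  rw [Finset.card_filter, Nat.cast_sum]
  refine Finset.sum_congr rfl fun i _ => ?_
  rcases zmod_two_eq_zero_or_one (c i) with h | h <;> simp [h]

theorem hammingNorm_add {ι : Type} [Fintype ι] (c d : ι → ZMod 2) :
    hammingNorm (c + d) + 2 * hammingNorm (c * d) = hammingNorm c + hammingNorm d := by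
  unfold hammingNorm
  simp only [Finset.card_filter, Finset.mul_sum, ← Finset.sum_add_distrib]
  refine Finset.sum_congr rfl fun i _ => ?_
  rcases zmod_two_eq_zero_or_one (c i) with h | h <;>
  rcases zmod_two_eq_zero_or_one (d i) with h' | h' <;> simp [h, h', CharTwo.add_self_eq_zero]

/-- Twice the size of the intersection of two supports is `|c| + |d| - |c + d|`, a multiple of 4. -/
theorem IsDoublyEven.sum_mul_eq_zero {ι : Type} [Fintype ι] {C : BinaryCode ι}
    (hC : C.IsDoublyEven) {c d : ι → ZMod 2} (hc : c ∈ C) (hd : d ∈ C) : ∑ i, c i * d i = 0 := by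
  have h := hammingNorm_add c d
  have h1 := hC c hc
  have h2 := hC d hd
  have h3 := hC _ (C.add_mem hc hd)
  have h4 : 2 ∣ hammingNorm (c * d) := by omega
  have h5 := natCast_hammingNorm (c * d)
  rw [(ZMod.natCast_eq_zero_iff _ 2).2 h4] at h5
  simpa using h5.symm

theorem sum_extend_mul {ι P : Type} [Fintype ι] [Fintype P] {f : P → ι}
    (hf : Function.Injective f) (c : P → ZMod 2) (t : ι → ZMod 2) :
    ∑ i, (Function.extend f c 0 : ι → ZMod 2) i * t i = ∑ p, c p * t (f p) := by
  classical
  symm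
  rw [← Finset.sum_subset (Finset.subset_univ (Finset.univ.map ⟨f, hf⟩))]
  · simp [hf.extend_apply]
  · intro i _ hi
    rw [Function.extend_apply' _ _ _ (by simpa using hi)]
    simp

/-! ### Explicit form of the codewords of the blocks -/

theorem mem_simplex {k : ℕ} {c : {v : Fin k → ZMod 2 // v ≠ 0} → ZMod 2} :
    c ∈ simplex k ↔ ∃ a : Fin k → ZMod 2, ∀ v, c v = ∑ i, a i * v.1 i := by
  unfold simplex
  rw [Submodule.mem_span_range_iff_exists_fun]
  refine exists_congr fun a => ?_
  rw [funext_iff]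
  refine forall_congr' fun v => ?_
  simp [Finset.sum_apply, eq_comm]

theorem mem_firstOrderReedMuller {m : ℕ} {c : (Fin m → ZMod 2) → ZMod 2} :
    c ∈ firstOrderReedMuller m ↔
      ∃ (b : ZMod 2) (a : Fin m → ZMod 2), ∀ v, c v = b + ∑ i, a i * v i := by
  unfold firstOrderReedMuller
  rw [Submodule.mem_span_insert]
  refine exists_congr fun b => ?_
  constructor
  · rintro ⟨z, hz, rfl⟩
    rw [Submodule.mem_span_range_iff_exists_fun] at hz
    obtain ⟨a, rfl⟩ := hz
    exact ⟨a, fun v => by simp [Finset.sum_apply]⟩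
  · rintro ⟨a, ha⟩
    refine ⟨∑ i, a i • fun v : Fin m → ZMod 2 => v i, ?_, ?_⟩
    · exact Submodule.mem_span_range_iff_exists_fun _ |>.2 ⟨a, rfl⟩
    · funext v
      simp [ha, Finset.sum_apply]

theorem mem_repetition_parityCheck {m k : ℕ} {c : Fin m × Fin (k + 1) → ZMod 2} :
    c ∈ repetition m (parityCheck k) ↔
      ∃ d : Fin (k + 1) → ZMod 2, ∑ i, d i = 0 ∧ ∀ x i, c (x, i) = d i := by
  unfold repetition
  rw [Submodule.mem_map]
  refine exists_congr fun d => and_congr Iff.rfl ?_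
  constructor
  · rintro rfl x i
    rfl
  · intro h
    funext ⟨x, i⟩
    exact (h x i).symm

/-! ### Embedded blocks, and finite facts on affine functions on `𝔽₂³` -/

/-- The injection `f` of positions carries the code `D` into the code `C`. -/
def EmbedsVia {ι P : Type} (D : BinaryCode P) (f : P → ι) (C : BinaryCode ι) : Prop :=
  Function.Injective f ∧ ∀ c ∈ D, Function.extend f c 0 ∈ C

/-- The dimension of a building block. -/
def Block.rank : Block → ℕ
  | .simplexThree => 3
  | .reedMullerFour => 4
  | .doubledParityCheck k _ => k

theorem Block.rank_le_card (b : Block) : b.rank ≤ Fintype.card b.Pos := by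
  cases b with
  | simplexThree =>
    change 3 ≤ Fintype.card {v : Fin 3 → ZMod 2 // v ≠ 0}
    rw [Fintype.card_subtype_compl]; simp
  | reedMullerFour =>
    change 4 ≤ Fintype.card (Fin 3 → ZMod 2)
    simp
  | doubledParityCheck k hk =>
    change k ≤ Fintype.card (Fin 2 × Fin (k + 1))
    simp; omega

theorem EmbedsVia.sum_eq_zero {ι P : Type} [Fintype ι] [Fintype P] {C : BinaryCode ι}
    (hC : C.IsDoublyEven) {D : BinaryCode P} {f : P → ι} (h : D.EmbedsVia f C)
    {c : P → ZMod 2} (hc : c ∈ D) {t : ι → ZMod 2} (ht : t ∈ C) :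
    ∑ p, c p * t (f p) = 0 := by
  rw [← sum_extend_mul h.1]
  exact hC.sum_mul_eq_zero (h.2 c hc) ht

theorem univ_fin_three_zmod_two : (Finset.univ : Finset (Fin 3 → ZMod 2)) =
    {![0,0,0], ![0,0,1], ![0,1,0], ![0,1,1], ![1,0,0], ![1,0,1], ![1,1,0], ![1,1,1]} := by
  decide

/-- A word on `𝔽₂³` orthogonal to all affine functions is an affine function. -/
theorem affine_of_orthogonal (u : (Fin 3 → ZMod 2) → ZMod 2) (h1 : ∑ v, u v = 0)
    (h2 : ∀ i, ∑ v, v i * u v = 0) :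
    ∃ (b : ZMod 2) (a : Fin 3 → ZMod 2), ∀ v, u v = b + ∑ i, a i * v i := by
  -- The unknowns are the eight values in the order of `univ_fin_three_zmod_two`. The four relations
  -- express the values at the sums of two or three unit vectors by those at the origin and the unit
  -- vectors, exactly as for an affine function.
  have key : ∀ x0 x1 x2 x3 x4 x5 x6 x7 : ZMod 2,
      x0 + (x1 + (x2 + (x3 + (x4 + (x5 + (x6 + x7)))))) = 0 → x4 + (x5 + (x6 + x7)) = 0 →
      x2 + (x3 + (x6 + x7)) = 0 → x1 + (x3 + (x5 + x7)) = 0 →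
      x3 = x0 + (x2 + x0) + (x1 + x0) ∧ x5 = x0 + (x4 + x0) + (x1 + x0) ∧
      x6 = x0 + (x4 + x0) + (x2 + x0) ∧ x7 = x0 + (x4 + x0) + (x2 + x0) + (x1 + x0) := by
    decide
  have hs : ∀ F : (Fin 3 → ZMod 2) → ZMod 2, ∑ v, F v = F ![0,0,0] + (F ![0,0,1] + (F ![0,1,0] +
      (F ![0,1,1] + (F ![1,0,0] + (F ![1,0,1] + (F ![1,1,0] + F ![1,1,1])))))) := by
    intro F
    rw [univ_fin_three_zmod_two]
    repeat rw [Finset.sum_insert (by decide)]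
    rw [Finset.sum_singleton]
  have h3 := h2 0
  have h4 := h2 1
  have h5 := h2 2
  rw [hs] at h1 h3 h4 h5
  simp at h3 h4 h5
  obtain ⟨k3, k5, k6, k7⟩ := key _ _ _ _ _ _ _ _ h1 h3 h4 h5
  refine ⟨u ![0,0,0], ![u ![1,0,0] + u ![0,0,0], u ![0,1,0] + u ![0,0,0], u ![0,0,1] + u ![0,0,0]],
    fun v => ?_⟩
  have hv : v ∈ (Finset.univ : Finset (Fin 3 → ZMod 2)) := Finset.mem_univ v
  rw [univ_fin_three_zmod_two] at hv
  have e : ∀ x y : ZMod 2, x = y + (x + y) := by decide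
  simp only [Finset.mem_insert, Finset.mem_singleton] at hv
  rcases hv with rfl | rfl | rfl | rfl | rfl | rfl | rfl | rfl <;>
    simp only [Fin.sum_univ_three] <;> simp [k3, k5, k6, k7, ← add_assoc] <;>
    generalize u ![0,0,0] = a <;> generalize u ![1,0,0] = b <;> generalize u ![0,1,0] = c <;>
    generalize u ![0,0,1] = d <;> revert a b c d <;> decide

theorem affine_hammingNorm : ∀ (b : ZMod 2) (a : Fin 3 → ZMod 2), a ≠ 0 →
    hammingNorm (fun v : Fin 3 → ZMod 2 => b + ∑ i, a i * v i) = 4 := by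
  decide

theorem linear_hammingNorm : ∀ (a : Fin 3 → ZMod 2), a ≠ 0 →
    hammingNorm (fun v : {v : Fin 3 → ZMod 2 // v ≠ 0} => ∑ i, a i * v.1 i) = 4 := by
  decide

/-- This and the next three facts serve `Block.linked`: any two positions lie in a common word of
weight 4, and such a word has minimal support because all nonconstant words have that weight. -/
theorem exists_linear_ne_zero : ∀ p q : Fin 3 → ZMod 2, p = 0 ∨ q = 0 ∨ ∃ a : Fin 3 → ZMod 2,
   ∑ i, a i * p i ≠ 0 ∧ ∑ i, a i * q i ≠ 0 := by
  decide

theorem linear_minimal : ∀ (a a' : Fin 3 → ZMod 2), (∀ v : Fin 3 → ZMod 2, v ≠ 0 → ∑ i, a i * v i = 0 → ∑ i, a' i * v i = 0) →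
   a' = 0 ∨ a' = a := by
  decide

theorem exists_affine_ne_zero : ∀ (p q : Fin 3 → ZMod 2), ∃ a : Fin 3 → ZMod 2, a ≠ 0 ∧ ∃ b,
   b + ∑ i, a i * p i ≠ 0 ∧ b + ∑ i, a i * q i ≠ 0 := by
  decide

theorem affine_minimal : ∀ (a a' : Fin 3 → ZMod 2), a ≠ 0 → ∀ b b', (∀ v : Fin 3 → ZMod 2, b + ∑ i, a i * v i = 0 → b' + ∑ i, a' i * v i = 0) →
   (b' = 0 ∧ a' = 0) ∨ (b' = b ∧ a' = a) := by
  decide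

/-! ### Weight-4 words against Reed–Muller and simplex blocks -/

/-- The word `t` vanishes on the image of `D` under `f`, or comes from a codeword of `D`. -/
def Absorbs {ι P : Type} (D : BinaryCode P) (f : P → ι) (t : ι → ZMod 2) : Prop :=
  (∀ p, t (f p) = 0) ∨ ((fun p => t (f p)) ∈ D ∧ ∀ i, (∀ p, f p ≠ i) → t i = 0)

/-- The code is self-dual, so the restriction of `t` is a codeword. It is not the all-one word, of
weight 8; if it is nonzero it already has weight 4, so nothing of `t` is left outside. -/
theorem reedMuller_absorbs {ι : Type} [Fintype ι] {C : BinaryCode ι} (hC : C.IsDoublyEven)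
    {f : (Fin 3 → ZMod 2) → ι} (hf : (firstOrderReedMuller 3).EmbedsVia f C)
    {t : ι → ZMod 2} (ht : t ∈ C) (hw : hammingNorm t = 4) :
    (firstOrderReedMuller 3).Absorbs f t := by
  have h1 : ∑ v, t (f v) = 0 := by
    have := hf.sum_eq_zero hC (c := fun _ => 1)
      (mem_firstOrderReedMuller.2 ⟨1, 0, fun v => by simp⟩) ht
    simpa using this
  have h2 : ∀ i, ∑ v : Fin 3 → ZMod 2, v i * t (f v) = 0 := fun i =>
    hf.sum_eq_zero hC (c := fun v : Fin 3 → ZMod 2 => v i)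
      (mem_firstOrderReedMuller.2 ⟨0, Pi.single i 1, fun v => by simp [Pi.single_apply]⟩) ht
  obtain ⟨b, a, hu⟩ := affine_of_orthogonal (fun v => t (f v)) h1 h2
  have hle := hammingNorm_comp_le hf.1 t
  by_cases ha : a = 0
  · subst ha
    rcases zmod_two_eq_zero_or_one b with rfl | rfl
    · left
      intro p
      simpa using hu p
    · exfalso
      have : (fun v => t (f v)) = fun _ => 1 := by
        funext v
        simpa using hu v
      rw [this, hw] at hle
      revert hle
      decide
  · right
    refine ⟨mem_firstOrderReedMuller.2 ⟨b, a, hu⟩, eq_zero_of_hammingNorm_le hf.1 ?_⟩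
    rw [funext hu, affine_hammingNorm b a ha, hw]

theorem exists_outside {ι P : Type} [Fintype ι] [Fintype P] {f : P → ι}
    (hf : Function.Injective f) {t : ι → ZMod 2}
    (h : hammingNorm (fun p => t (f p)) < hammingNorm t) : ∃ x, (∀ p, f p ≠ x) ∧ t x = 1 := by
  by_contra! hx
  have h0 : ∀ i, (∀ p, f p ≠ i) → t i = 0 := fun i hi => by
    by_contra h2
    exact hx i hi (zmod_two_ne_zero_iff.1 h2)
  have h1 : Function.extend f (fun p => t (f p)) 0 = t := extend_eq_of_comp hf (fun _ => rfl) h0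
  have h2 := hammingNorm_extend hf (fun p => t (f p))
  rw [h1] at h2
  omega

/-- The dual of the simplex code is the Hamming code, which is the Reed–Muller code with the
position at the origin removed. A restriction outside the simplex code has weight 3, and the fourth
position of `t` supplies the missing origin. -/
theorem simplex_absorbs {ι : Type} [Fintype ι] {C : BinaryCode ι} (hC : C.IsDoublyEven)
    {f : {v : Fin 3 → ZMod 2 // v ≠ 0} → ι} (hf : (simplex 3).EmbedsVia f C)
    {t : ι → ZMod 2} (ht : t ∈ C) (hw : hammingNorm t = 4) :
    (simplex 3).Absorbs f t ∨ ∃ f', (firstOrderReedMuller 3).EmbedsVia f' C := by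
  have hs : ∀ F : (Fin 3 → ZMod 2) → ZMod 2, ∑ v, F v = F 0 +
      ∑ v : {v : Fin 3 → ZMod 2 // v ≠ 0}, F v.1 := by
    intro F
    rw [Fintype.sum_eq_add_sum_compl 0]
    congr 1
  -- The value at the origin is a parity bit, which makes `u` orthogonal to the all-one word as
  -- well.
  set u : (Fin 3 → ZMod 2) → ZMod 2 := fun v =>
    if h : v ≠ 0 then t (f ⟨v, h⟩) else ∑ w, t (f w) with hu
  have hu1 : ∀ v : {v : Fin 3 → ZMod 2 // v ≠ 0}, u v.1 = t (f v) := fun v => by simp [hu, v.2]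
  have hu0 : u 0 = ∑ w, t (f w) := by simp [hu]
  have h1 : ∑ v, u v = 0 := by
    rw [hs, hu0]
    simp only [hu1]
    exact CharTwo.add_self_eq_zero _
  have h2 : ∀ i, ∑ v : Fin 3 → ZMod 2, v i * u v = 0 := by
    intro i
    rw [hs]
    simp only [Pi.zero_apply, zero_mul, zero_add]
    exact hf.sum_eq_zero hC (c := fun v => v.1 i)
      (mem_simplex.2 ⟨Pi.single i 1, fun v => by simp [Pi.single_apply]⟩) ht
  obtain ⟨b, a, hua⟩ := affine_of_orthogonal u h1 h2
  have hle := hammingNorm_comp_le hf.1 t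
  rcases zmod_two_eq_zero_or_one b with rfl | rfl
  · left
    have htf : (fun v => t (f v)) = fun v => ∑ i, a i * v.1 i := by
      funext v
      rw [← hu1, hua, zero_add]
    by_cases ha : a = 0
    · left
      intro v
      simpa [ha] using congrFun htf v
    · right
      refine ⟨mem_simplex.2 ⟨a, congrFun htf⟩, eq_zero_of_hammingNorm_le hf.1 ?_⟩
      rw [htf, linear_hammingNorm a ha, hw]
  · right
    have htf : (fun v => t (f v)) = fun v => 1 + ∑ i, a i * v.1 i := by
      funext v
      rw [← hu1, hua]
    -- The complement of a linear function has weight 3 or 7 off the origin, and 7 exceeds the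
    -- weight of `t`.
    have hn : hammingNorm (fun v => t (f v)) = 3 := by
      rw [htf] at hle ⊢
      rw [hw] at hle
      revert hle
      clear * -
      revert a
      decide
    obtain ⟨x, hx, htx⟩ := exists_outside hf.1 (t := t) (by omega)
    set f' : (Fin 3 → ZMod 2) → ι := fun v => if h : v ≠ 0 then f ⟨v, h⟩ else x with hf'
    have hf'1 : ∀ v : {v : Fin 3 → ZMod 2 // v ≠ 0}, f' v.1 = f v := fun v => by simp [hf', v.2]
    have hf'0 : f' 0 = x := by simp [hf']
    have hinj : Function.Injective f' := by
      intro v w hvw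
      by_cases hv : v = 0 <;> by_cases hw : w = 0
      · rw [hv, hw]
      · rw [hv, hf'0, hf'1 ⟨w, hw⟩] at hvw
        exact absurd hvw.symm (hx _)
      · rw [hw, hf'0, hf'1 ⟨v, hv⟩] at hvw
        exact absurd hvw (hx _)
      · rw [hf'1 ⟨w, hw⟩, hf'1 ⟨v, hv⟩] at hvw
        exact congrArg Subtype.val (hf.1 hvw)
    have htu : ∀ v, t (f' v) = 1 + ∑ i, a i * v i := by
      intro v
      by_cases hv : v = 0
      · simp [hv, hf'0, htx]
      · rw [hf'1 ⟨v, hv⟩, ← hu1, hua]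
    have ht0 : ∀ i, (∀ p, f' p ≠ i) → t i = 0 := by
      refine eq_zero_of_hammingNorm_le hinj ?_
      rw [funext htu, hw]
      rw [htf] at hn
      revert hn
      clear * -
      revert a
      decide
    refine ⟨f', hinj, fun c hc => ?_⟩
    obtain ⟨β, α, hc⟩ := mem_firstOrderReedMuller.1 hc
    -- Adding `β • t` to the affine word cancels its constant term and leaves a linear word of the
    -- simplex code.
    have hm : (fun v => ∑ i, (α i + β * a i) * v.1 i) ∈ simplex 3 :=
      mem_simplex.2 ⟨fun i => α i + β * a i, fun _ => rfl⟩
    have hcC := C.add_mem (hf.2 _ hm) (C.smul_mem β ht)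
    convert hcC
    refine extend_eq_of_comp hinj (fun v => ?_) fun i hi => ?_
    · rw [Pi.add_apply, Pi.smul_apply, htu, hc, smul_eq_mul]
      by_cases hv : v = 0
      · subst hv
        rw [hf'0, Function.extend_apply' _ _ _ (by simpa using fun v h => hx ⟨v, h⟩)]
        simp
      · rw [hf'1 ⟨v, hv⟩, hf.1.extend_apply]
        simp only [add_mul, Finset.sum_add_distrib, mul_add, Finset.mul_sum, mul_one, mul_assoc]
        generalize ∑ i, β * (a i * v i) = s
        have := CharTwo.add_self_eq_zero s
        linear_combination this
    · rw [Pi.add_apply, Pi.smul_apply, ht0 i hi, smul_zero, add_zero,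
        Function.extend_apply' _ _ _ ?_, Pi.zero_apply]
      rintro ⟨v, rfl⟩
      exact hi v.1 (hf'1 v)

/-! ### Doubled parity check blocks: words constant on each pair -/

theorem hammingNorm_fin_two_prod {k : ℕ} (g : Fin 2 × Fin k → ZMod 2) :
    hammingNorm g = ∑ i, ((if g (0, i) ≠ 0 then 1 else 0) + if g (1, i) ≠ 0 then 1 else 0) := by
  unfold hammingNorm
  rw [Finset.card_filter, Fintype.sum_prod_type, Fin.sum_univ_two, Finset.sum_add_distrib]

/-- Orthogonality to the weight-4 word supported on the pairs `0` and `i`: either `t` is constant on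
every pair, or it meets every pair exactly once. -/
theorem doubledParity_column_sum {ι : Type} [Fintype ι] {C : BinaryCode ι} (hC : C.IsDoublyEven)
    {k : ℕ} {f : Fin 2 × Fin (k + 1) → ι} (hf : (repetition 2 (parityCheck k)).EmbedsVia f C)
    {t : ι → ZMod 2} (ht : t ∈ C) (i : Fin (k + 1)) :
    t (f (0, i)) + t (f (1, i)) = t (f (0, 0)) + t (f (1, 0)) := by
  have h := hf.sum_eq_zero hC
    (c := fun p => (Pi.single i 1 + Pi.single 0 1 : Fin (k + 1) → ZMod 2) p.2)
    (mem_repetition_parityCheck.2 ⟨_, by simp [Finset.sum_add_distrib, CharTwo.add_self_eq_zero],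
      fun _ _ => rfl⟩) ht
  simp only [Fintype.sum_prod_type, Fin.sum_univ_two, Pi.add_apply, add_mul, Pi.single_apply,
    ite_mul, one_mul, zero_mul, Finset.sum_add_distrib, Finset.sum_ite_eq',
    Finset.mem_univ, if_true] at h
  have h0 := CharTwo.add_self_eq_zero (t (f (0, 0)))
  have h1 := CharTwo.add_self_eq_zero (t (f (1, 0)))
  linear_combination h - h0 - h1

theorem exists_two_outside {ι P : Type} [Fintype ι] [Fintype P] {f : P → ι}
    (hf : Function.Injective f) {t : ι → ZMod 2}
    (h : hammingNorm (fun p => t (f p)) + 2 = hammingNorm t) :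
    ∃ x y, x ≠ y ∧ (∀ p, f p ≠ x) ∧ (∀ p, f p ≠ y) ∧ t x = 1 ∧ t y = 1 ∧
      ∀ i, (∀ p, f p ≠ i) → i ≠ x → i ≠ y → t i = 0 := by
  classical
  have h1 := hammingNorm_eq_comp_add hf t
  obtain ⟨x, y, hxy, he⟩ := Finset.card_eq_two.1
    (show (Finset.univ.filter fun i => t i ≠ 0 ∧ ∀ p, f p ≠ i).card = 2 by omega)
  have hm : ∀ i, i ∈ (Finset.univ.filter fun i => t i ≠ 0 ∧ ∀ p, f p ≠ i) ↔ i = x ∨ i = y := by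
    intro i
    rw [he]
    simp
  simp only [Finset.mem_filter, Finset.mem_univ, true_and] at hm
  have hx := (hm x).2 (Or.inl rfl)
  have hy := (hm y).2 (Or.inr rfl)
  refine ⟨x, y, hxy, hx.2, hy.2, zmod_two_ne_zero_iff.1 hx.1, zmod_two_ne_zero_iff.1 hy.1, ?_⟩
  intro i hi hix hiy
  by_contra h2
  rcases (hm i).1 ⟨h2, hi⟩ with h3 | h3
  · exact hix h3
  · exact hiy h3

/-- Here `t` consists of the pair `i` and two outside positions, which become a new pair, placed at
index `0` with the old pairs shifted by one. -/
theorem doubledParity_extend {ι : Type} {C : BinaryCode ι} {k : ℕ} {f : Fin 2 × Fin (k + 1) → ι}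
    (hf : (repetition 2 (parityCheck k)).EmbedsVia f C) {t : ι → ZMod 2} (ht : t ∈ C)
    {i : Fin (k + 1)} (hti : ∀ x j, t (f (x, j)) = (Pi.single i 1 : Fin (k + 1) → ZMod 2) j)
    {x y : ι} (hxy : x ≠ y) (hx : ∀ p, f p ≠ x) (hy : ∀ p, f p ≠ y) (htx : t x = 1) (hty : t y = 1)
    (ht0 : ∀ i, (∀ p, f p ≠ i) → i ≠ x → i ≠ y → t i = 0) :
    ∃ f', (repetition 2 (parityCheck (k + 1))).EmbedsVia f' C := by
  set g : Fin 2 → ι := ![x, y] with hg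
  have hgf : ∀ a p, f p ≠ g a := by
    intro a p
    fin_cases a
    · exact hx p
    · exact hy p
  have hgi : Function.Injective g := by
    intro a b
    fin_cases a <;> fin_cases b <;> simp [hg, hxy, hxy.symm]
  have hgt : ∀ a, t (g a) = 1 := by
    intro a
    fin_cases a
    · exact htx
    · exact hty
  set f' : Fin 2 × Fin (k + 1 + 1) → ι := fun p => Fin.cases (g p.1) (fun j => f (p.1, j)) p.2
    with hf'
  have hf'0 : ∀ a, f' (a, 0) = g a := fun a => rfl
  have hf's : ∀ a j, f' (a, Fin.succ j) = f (a, j) := fun a j => rfl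
  have hinj : Function.Injective f' := by
    rintro ⟨a, j⟩ ⟨b, l⟩ h
    induction j using Fin.cases with
    | zero =>
      induction l using Fin.cases with
      | zero => rw [hgi h]
      | succ l => exact absurd h.symm (hgf a (b, l))
    | succ j =>
      induction l using Fin.cases with
      | zero => exact absurd h (hgf b (a, j))
      | succ l =>
        have := hf.1 h
        rw [Prod.mk.injEq] at this
        obtain ⟨rfl, h2⟩ := this
        rw [show j = l from h2]
  refine ⟨f', hinj, fun c hc => ?_⟩
  obtain ⟨d, hd, hc⟩ := mem_repetition_parityCheck.1 hc
  rw [Fin.sum_univ_succ] at hd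
  -- A word using the new pair is `t` plus an old word; as `t` also covers the pair `i`, the old
  -- word is flipped there, which restores its parity.
  have hm : (fun p : Fin 2 × Fin (k + 1) => d p.2.succ + d 0 * (Pi.single i 1 : _ → ZMod 2) p.2) ∈
      repetition 2 (parityCheck k) := by
    refine mem_repetition_parityCheck.2
      ⟨fun j => d j.succ + d 0 * (Pi.single i 1 : _ → ZMod 2) j, ?_, fun _ _ => rfl⟩
    rw [Finset.sum_add_distrib, ← Finset.mul_sum]
    simp only [Finset.sum_pi_single', Finset.mem_univ, if_true]
    linear_combination hd
  have hcC := C.add_mem (hf.2 _ hm) (C.smul_mem (d 0) ht)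
  convert hcC
  refine extend_eq_of_comp hinj ?_ fun j hj => ?_
  · rintro ⟨a, j⟩
    rw [Pi.add_apply, Pi.smul_apply, hc, smul_eq_mul]
    induction j using Fin.cases with
    | zero =>
      rw [hf'0, hgt, Function.extend_apply' _ _ _ (by simpa using fun b l => hgf a (b, l))]
      simp
    | succ j =>
      rw [hf's, hti, hf.1.extend_apply]
      have := CharTwo.add_self_eq_zero (d 0 * (Pi.single i 1 : Fin (k + 1) → ZMod 2) j)
      linear_combination this
  · have hjf : ∀ p, f p ≠ j := fun p => hj (p.1, p.2.succ)
    rw [Pi.add_apply, Pi.smul_apply, ht0 j hjf (hj (0, 0)).symm (hj (1, 0)).symm, smul_zero,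
      add_zero, Function.extend_apply' _ _ _ (by simpa using fun a b => hjf (a, b)), Pi.zero_apply]

/-- By weight, `t` covers at most two pairs of the block. With none or two it is absorbed; with one
it lengthens the block. -/
theorem doubledParity_absorbs_of_column_sum_zero {ι : Type} [Fintype ι] {C : BinaryCode ι}
    {k : ℕ} {f : Fin 2 × Fin (k + 1) → ι}
    (hf : (repetition 2 (parityCheck k)).EmbedsVia f C) {t : ι → ZMod 2} (ht : t ∈ C)
    (hw : hammingNorm t = 4) (h0 : ∀ i, t (f (0, i)) + t (f (1, i)) = 0) :
    (repetition 2 (parityCheck k)).Absorbs f t ∨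
      ∃ f', (repetition 2 (parityCheck (k + 1))).EmbedsVia f' C := by
  set d : Fin (k + 1) → ZMod 2 := fun i => t (f (0, i)) with hd
  have htd : ∀ x i, t (f (x, i)) = d i := by
    intro x i
    have := CharTwo.add_eq_zero.1 (h0 i)
    fin_cases x
    · rfl
    · exact this.symm
  have hle := hammingNorm_comp_le hf.1 t
  have hn : hammingNorm (fun p => t (f p)) = 2 * hammingNorm d := by
    rw [hammingNorm_fin_two_prod]
    simp only [htd]
    unfold hammingNorm
    rw [Finset.card_filter, Finset.mul_sum]
    exact Finset.sum_congr rfl fun i _ => (two_mul _).symm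
  have hcast := natCast_hammingNorm d
  obtain h | h | h : hammingNorm d = 0 ∨ hammingNorm d = 1 ∨ hammingNorm d = 2 := by omega
  · rw [hammingNorm_eq_zero] at h
    left; left
    rintro ⟨x, i⟩
    rw [htd, h, Pi.zero_apply]
  · right
    obtain ⟨i, hi⟩ := Finset.card_eq_one.1 h
    have hdi : d = Pi.single i 1 := by
      funext j
      have hj : j ∈ (Finset.univ.filter fun i => d i ≠ 0) ↔ j = i := by rw [hi]; simp
      simp only [Finset.mem_filter, Finset.mem_univ, true_and] at hj
      by_cases hji : j = i
      · subst hji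
        simpa using zmod_two_ne_zero_iff.1 (hj.2 rfl)
      · rw [Pi.single_eq_of_ne hji]
        by_contra h2
        exact hji (hj.1 h2)
    obtain ⟨x, y, hxy, hx, hy, htx, hty, ht0⟩ := exists_two_outside hf.1 (t := t) (by omega)
    exact doubledParity_extend hf ht (fun x j => by rw [htd, hdi]) hxy hx hy htx hty ht0
  · left; right
    refine ⟨mem_repetition_parityCheck.2 ⟨d, ?_, htd⟩, eq_zero_of_hammingNorm_le hf.1 (by omega)⟩
    rw [← hcast, h]
    decide

/-- Common frame for enlarging a block by `t`: each word of the larger code is a word of the old one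
plus a multiple of `t`. -/
theorem EmbedsVia.of_add_smul {ι P P' : Type} {C : BinaryCode ι} {D : BinaryCode P}
    {D' : BinaryCode P'} {f : P → ι} (hf : D.EmbedsVia f C) {f' : P' → ι}
    (hf' : Function.Injective f') {t : ι → ZMod 2} (ht : t ∈ C)
    (ht0 : ∀ i, (∀ p, f' p ≠ i) → t i = 0) (hr : ∀ p, ∃ q, f' q = f p)
    (h : ∀ c ∈ D', ∃ d ∈ D, ∃ α : ZMod 2,
      ∀ q, (Function.extend f d 0 : ι → ZMod 2) (f' q) + α * t (f' q) = c q) :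
    D'.EmbedsVia f' C := by
  refine ⟨hf', fun c hc => ?_⟩
  obtain ⟨d, hd, α, hα⟩ := h c hc
  have hcC := C.add_mem (hf.2 _ hd) (C.smul_mem α ht)
  convert hcC
  refine extend_eq_of_comp hf' hα fun i hi => ?_
  rw [Pi.add_apply, Pi.smul_apply, ht0 i hi, smul_zero, add_zero, Function.extend_apply',
    Pi.zero_apply]
  rintro ⟨p, rfl⟩
  obtain ⟨q, hq⟩ := hr p
  exact hi q hq

/-- The position of the pair with index `i` at which `t` takes the value `x`, if `τ` is the value
of `t` at the first position of the pair. -/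
def pairPos (τ x : ZMod 2) : Fin 2 := (τ + x : ZMod 2)

theorem exists_pairPos (τ : ZMod 2) (a : Fin 2) : ∃ x, pairPos τ x = a := by
  revert τ a; decide

theorem apply_pairPos {τ : ZMod 2} {g : Fin 2 → ZMod 2} (h0 : g 0 = τ) (h1 : g 0 + g 1 = 1)
    (x : ZMod 2) : g (pairPos τ x) = x := by
  subst h0
  revert g x
  decide

theorem hammingNorm_of_column_sum_one {ι : Type} {k : ℕ} {f : Fin 2 × Fin k → ι} {t : ι → ZMod 2}
    (h1 : ∀ i, t (f (0, i)) + t (f (1, i)) = 1) : hammingNorm (fun p => t (f p)) = k := by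
  rw [hammingNorm_fin_two_prod]
  have : ∀ a b : ZMod 2, a + b = 1 → ((if a ≠ 0 then 1 else 0) + if b ≠ 0 then 1 else 0) = 1 := by
    decide
  rw [Finset.sum_congr rfl fun i _ => this _ _ (h1 i)]
  simp

/-! ### Doubled parity check blocks: words meeting each pair once -/

section ColumnSumOne

variable {ι : Type} [Fintype ι] {C : BinaryCode ι}

/-- Label the four pairs by `𝔽₂²` and the two positions of a pair by the value of `t`. Even-weight
words on four pairs are the affine functions of the label, and `t` is the remaining coordinate
function. -/
theorem exists_reedMuller_of_column_sum_one {f : Fin 2 × Fin (3 + 1) → ι}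
    (hf : (repetition 2 (parityCheck 3)).EmbedsVia f C) {t : ι → ZMod 2} (ht : t ∈ C)
    (hw : hammingNorm t = 4) (h1 : ∀ i, t (f (0, i)) + t (f (1, i)) = 1) :
    ∃ f', (firstOrderReedMuller 3).EmbedsVia f' C := by
  -- `idx` and `r` are inverse labellings of the pairs; the vanishing sums say that the coordinate
  -- functions of the label are parity check words.
  obtain ⟨idx, r, hr, hidx⟩ : ∃ (idx : ZMod 2 → ZMod 2 → Fin (3 + 1))
      (r : Fin 2 → Fin (3 + 1) → ZMod 2), (∀ x y, r 0 (idx x y) = x ∧ r 1 (idx x y) = y) ∧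
      (∀ i, idx (r 0 i) (r 1 i) = i) ∧ ∑ i, r 0 i = 0 ∧ ∑ i, r 1 i = 0 :=
    ⟨fun x y => if x = 0 then (if y = 0 then 0 else 1) else if y = 0 then 2 else 3,
      ![![0, 0, 1, 1], ![0, 1, 0, 1]], by decide, by decide⟩
  set f' : (Fin 3 → ZMod 2) → ι := fun v =>
    f (pairPos (t (f (0, idx (v 1) (v 2)))) (v 0), idx (v 1) (v 2)) with hf'
  have htf : ∀ v, t (f' v) = v 0 := fun v =>
    apply_pairPos (g := fun x => t (f (x, idx (v 1) (v 2)))) rfl (h1 _) _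
  have hinj : Function.Injective f' := by
    intro v w hvw
    have h := hf.1 hvw
    rw [Prod.mk.injEq] at h
    have e1 : v 1 = w 1 := by rw [← (hr (v 1) (v 2)).1, h.2, (hr _ _).1]
    have e2 : v 2 = w 2 := by rw [← (hr (v 1) (v 2)).2, h.2, (hr _ _).2]
    have e0 : v 0 = w 0 := by rw [← htf v, hvw, htf]
    funext j
    fin_cases j
    · exact e0
    · exact e1
    · exact e2
  refine ⟨f', hf.of_add_smul hinj ht (eq_zero_of_hammingNorm_le hinj ?_) ?_ ?_⟩
  · rw [funext htf, hw]
    decide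
  · rintro ⟨a, i⟩
    obtain ⟨x, hx⟩ := exists_pairPos (t (f (0, i))) a
    refine ⟨![x, r 0 i, r 1 i], ?_⟩
    simp [hf', hidx.1, hx]
  · intro c hc
    obtain ⟨β, α, hc⟩ := mem_firstOrderReedMuller.1 hc
    refine ⟨fun p => β + α 1 * r 0 p.2 + α 2 * r 1 p.2, mem_repetition_parityCheck.2
      ⟨fun i => β + α 1 * r 0 i + α 2 * r 1 i, ?_, fun _ _ => rfl⟩, α 0, fun v => ?_⟩
    · rw [Finset.sum_add_distrib, Finset.sum_add_distrib, ← Finset.mul_sum, ← Finset.mul_sum,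
        hidx.2.1, hidx.2.2]
      have h4 : ∀ x : ZMod 2, x + x + x + x = 0 := by decide
      rw [Fin.sum_univ_four, mul_zero, mul_zero, add_zero, add_zero]
      exact h4 β
    · rw [htf, hc, hf', hf.1.extend_apply, Fin.sum_univ_three]
      simp only [(hr _ _).1, (hr _ _).2]
      ring

/-- As for four pairs, but the three pairs carry the nonzero labels of `𝔽₂²`, and the single
position of `t` outside the block becomes the vector `(1, 0, 0)`. -/
theorem exists_simplex_of_column_sum_one {f : Fin 2 × Fin (2 + 1) → ι}
    (hf : (repetition 2 (parityCheck 2)).EmbedsVia f C) {t : ι → ZMod 2} (ht : t ∈ C)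
    (hw : hammingNorm t = 4) (h1 : ∀ i, t (f (0, i)) + t (f (1, i)) = 1) :
    ∃ f', (simplex 3).EmbedsVia f' C := by
  obtain ⟨idx, r, hr, hidx⟩ : ∃ (idx : ZMod 2 → ZMod 2 → Fin (2 + 1))
      (r : Fin 2 → Fin (2 + 1) → ZMod 2),
      (∀ x y, ¬(x = 0 ∧ y = 0) → r 0 (idx x y) = x ∧ r 1 (idx x y) = y) ∧
      (∀ i, ¬(r 0 i = 0 ∧ r 1 i = 0) ∧ idx (r 0 i) (r 1 i) = i) ∧
      ∑ i, r 0 i = 0 ∧ ∑ i, r 1 i = 0 :=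
    -- The value at the label `(0, 0)` is arbitrary.
    ⟨fun x y => if x = 0 then 0 else if y = 0 then 1 else 2,
      ![![0, 1, 1], ![1, 0, 1]], by decide, by decide⟩
  obtain ⟨z, hz, htz⟩ := exists_outside hf.1 (t := t)
    (by rw [hammingNorm_of_column_sum_one h1]; omega)
  set f' : {v : Fin 3 → ZMod 2 // v ≠ 0} → ι := fun v =>
    if v.1 1 = 0 ∧ v.1 2 = 0 then z else
    f (pairPos (t (f (0, idx (v.1 1) (v.1 2)))) (v.1 0), idx (v.1 1) (v.1 2)) with hf'
  have hf'z : ∀ v, v.1 1 = 0 ∧ v.1 2 = 0 → f' v = z := fun v h => if_pos h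
  have hf'f : ∀ v, ¬(v.1 1 = 0 ∧ v.1 2 = 0) → f' v =
    f (pairPos (t (f (0, idx (v.1 1) (v.1 2)))) (v.1 0), idx (v.1 1) (v.1 2)) :=
    fun v h => if_neg h
  have hv0 : ∀ v : {v : Fin 3 → ZMod 2 // v ≠ 0}, v.1 1 = 0 ∧ v.1 2 = 0 → v.1 0 = 1 := by decide
  have htf : ∀ v, t (f' v) = v.1 0 := by
    intro v
    by_cases hv : v.1 1 = 0 ∧ v.1 2 = 0
    · rw [hf'z v hv, htz, hv0 v hv]
    · rw [hf'f v hv]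
      exact apply_pairPos (g := fun x => t (f (x, idx (v.1 1) (v.1 2)))) rfl (h1 _) _
  have hinj : Function.Injective f' := by
    intro v w hvw
    have e0 : v.1 0 = w.1 0 := by rw [← htf, hvw, htf]
    have e12 : v.1 1 = w.1 1 ∧ v.1 2 = w.1 2 := by
      by_cases hv : v.1 1 = 0 ∧ v.1 2 = 0 <;> by_cases hw : w.1 1 = 0 ∧ w.1 2 = 0
      · exact ⟨hv.1.trans hw.1.symm, hv.2.trans hw.2.symm⟩
      · rw [hf'z v hv, hf'f w hw] at hvw
        exact absurd hvw.symm (hz _)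
      · rw [hf'f v hv, hf'z w hw] at hvw
        exact absurd hvw (hz _)
      · rw [hf'f v hv, hf'f w hw] at hvw
        have h := hf.1 hvw
        rw [Prod.mk.injEq] at h
        constructor
        · rw [← (hr _ _ hv).1, h.2, (hr _ _ hw).1]
        · rw [← (hr _ _ hv).2, h.2, (hr _ _ hw).2]
    refine Subtype.ext (funext fun j => ?_)
    fin_cases j
    · exact e0
    · exact e12.1
    · exact e12.2
  refine ⟨f', hf.of_add_smul hinj ht (eq_zero_of_hammingNorm_le hinj ?_) ?_ ?_⟩
  · rw [funext htf, hw]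
    decide
  · rintro ⟨a, i⟩
    obtain ⟨x, hx⟩ := exists_pairPos (t (f (0, i))) a
    refine ⟨⟨![x, r 0 i, r 1 i], fun h => (hidx.1 i).1 ⟨?_, ?_⟩⟩, ?_⟩
    · simpa using congrFun h 1
    · simpa using congrFun h 2
    · rw [hf'f _ (by simpa using (hidx.1 i).1)]
      simp [(hidx.1 i).2, hx]
  · intro c hc
    obtain ⟨α, hc⟩ := mem_simplex.1 hc
    refine ⟨fun p => α 1 * r 0 p.2 + α 2 * r 1 p.2, mem_repetition_parityCheck.2
      ⟨fun i => α 1 * r 0 i + α 2 * r 1 i, ?_, fun _ _ => rfl⟩, α 0, fun v => ?_⟩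
    · rw [Finset.sum_add_distrib, ← Finset.mul_sum, ← Finset.mul_sum,
        hidx.2.1, hidx.2.2]
      simp
    · rw [htf, hc, Fin.sum_univ_three]
      by_cases hv : v.1 1 = 0 ∧ v.1 2 = 0
      · rw [hf'z v hv, Function.extend_apply' _ _ _ (by simpa using fun a b => hz (a, b)), hv.1,
          hv.2, Pi.zero_apply]
        ring
      · rw [hf'f v hv, hf.1.extend_apply]
        simp only [(hr _ _ hv).1, (hr _ _ hv).2]
        ring

/-- For `k = 1` the only nonzero word is all-one, so the four positions may be paired anew. Pairing
positions with equal values of `t` reduces to the case of vanishing column sums, where `t` covers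
exactly one pair and lengthens the block. -/
theorem exists_parityTwo_of_column_sum_one {f : Fin 2 × Fin (1 + 1) → ι}
    (hf : (repetition 2 (parityCheck 1)).EmbedsVia f C) {t : ι → ZMod 2} (ht : t ∈ C)
    (hw : hammingNorm t = 4) (h1 : ∀ i, t (f (0, i)) + t (f (1, i)) = 1) :
    ∃ f', (repetition 2 (parityCheck 2)).EmbedsVia f' C := by
  obtain ⟨bit, hbi, hbs, hb0, hb1⟩ : ∃ bit : Fin 2 → ZMod 2, Function.Injective bit ∧
      (∀ x, ∃ i, bit i = x) ∧ bit 0 = 0 ∧ bit 1 = 1 := ⟨![0, 1], by decide, by decide, rfl, rfl⟩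
  set f' : Fin 2 × Fin (1 + 1) → ι := fun p =>
    f (pairPos (t (f (0, p.1))) (bit p.2), p.1) with hf'
  have htf : ∀ p, t (f' p) = bit p.2 := fun p =>
    apply_pairPos (g := fun x => t (f (x, p.1))) rfl (h1 _) _
  have hinj : Function.Injective f' := by
    rintro ⟨a, i⟩ ⟨b, j⟩ h
    have h2 := hf.1 h
    rw [Prod.mk.injEq] at h2
    have hij : i = j := hbi ((htf (a, i)).symm.trans ((congrArg t h).trans (htf (b, j))))
    have hab : a = b := h2.2
    rw [hij, hab]
  have hfe : (repetition 2 (parityCheck 1)).EmbedsVia f' C := by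
    refine ⟨hinj, fun c hc => ?_⟩
    obtain ⟨d, hd, hc⟩ := mem_repetition_parityCheck.1 hc
    rw [Fin.sum_univ_two] at hd
    have hd' : d 0 = d 1 := CharTwo.add_eq_zero.1 hd
    have hd2 : ∀ i, d i = d 0 := by
      intro i
      fin_cases i
      · rfl
      · exact hd'.symm
    have hcc : ∀ p, c p = d 0 := fun p => (hc p.1 p.2).trans (hd2 _)
    convert hf.2 c (mem_repetition_parityCheck.2 ⟨d, by rwa [Fin.sum_univ_two], hc⟩) using 1
    refine extend_eq_of_comp hinj (fun p => ?_) fun i hi => ?_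
    · rw [hf', hf.1.extend_apply, hcc, hcc]
    · rw [Function.extend_apply', Pi.zero_apply]
      rintro ⟨⟨a, j⟩, rfl⟩
      obtain ⟨x, hx⟩ := exists_pairPos (t (f (0, j))) a
      obtain ⟨l, rfl⟩ := hbs x
      exact hi (j, l) (congrArg (fun b => f (b, j)) hx)
  have h2 : ∀ i, t (f' (0, i)) + t (f' (1, i)) = 0 := by
    intro i
    rw [htf, htf]
    exact CharTwo.add_self_eq_zero _
  rcases doubledParity_absorbs_of_column_sum_zero hfe ht hw h2 with h | h
  · exfalso
    rcases h with h | ⟨h, h0⟩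
    · have := htf (0, 1)
      rw [h, hb1] at this
      revert this
      decide
    · obtain ⟨d, hd, hc⟩ := mem_repetition_parityCheck.1 h
      have e0 := (hc 0 0).symm.trans (htf (0, 0))
      have e1 := (hc 0 1).symm.trans (htf (0, 1))
      rw [Fin.sum_univ_two, e0, e1, hb0, hb1] at hd
      revert hd
      decide
  · exact h

end ColumnSumOne

theorem doubledParity_absorbs {ι : Type} [Fintype ι] {C : BinaryCode ι} (hC : C.IsDoublyEven)
    {k : ℕ} (hk : 1 ≤ k) {f : Fin 2 × Fin (k + 1) → ι}
    (hf : (repetition 2 (parityCheck k)).EmbedsVia f C) {t : ι → ZMod 2} (ht : t ∈ C)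
    (hw : hammingNorm t = 4) :
    (repetition 2 (parityCheck k)).Absorbs f t ∨
      (∃ f', (repetition 2 (parityCheck (k + 1))).EmbedsVia f' C) ∨
      (k = 2 ∧ ∃ f', (simplex 3).EmbedsVia f' C) ∨
      (k = 3 ∧ ∃ f', (firstOrderReedMuller 3).EmbedsVia f' C) := by
  have hs := doubledParity_column_sum hC hf ht
  rcases zmod_two_eq_zero_or_one (t (f (0, 0)) + t (f (1, 0))) with h | h <;> rw [h] at hs
  · rcases doubledParity_absorbs_of_column_sum_zero hf ht hw hs with h2 | h2
    · exact Or.inl h2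
    · exact Or.inr (Or.inl h2)
  · have hle := hammingNorm_comp_le hf.1 t
    rw [hammingNorm_of_column_sum_one hs, hw] at hle
    -- One position in each of `k + 1` pairs, and weight 4 in total.
    obtain rfl | rfl | rfl : k = 1 ∨ k = 2 ∨ k = 3 := by omega
    · exact Or.inr (Or.inl (exists_parityTwo_of_column_sum_one hf ht hw hs))
    · exact Or.inr (Or.inr (Or.inl ⟨rfl, exists_simplex_of_column_sum_one hf ht hw hs⟩))
    · exact Or.inr (Or.inr (Or.inr ⟨rfl, exists_reedMuller_of_column_sum_one hf ht hw hs⟩))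

/-! ### Growing a block until it absorbs all weight-4 words -/

theorem Block.absorbs_or_exists_rank_lt {ι : Type} [Fintype ι] {C : BinaryCode ι}
    (hC : C.IsDoublyEven) {b : Block} {f : b.Pos → ι} (hf : b.code.EmbedsVia f C)
    {t : ι → ZMod 2} (ht : t ∈ C) (hw : hammingNorm t = 4) :
    b.code.Absorbs f t ∨
      ∃ (b' : Block) (f' : b'.Pos → ι), b'.code.EmbedsVia f' C ∧ b.rank < b'.rank := by
  cases b with
  | simplexThree =>
    rcases simplex_absorbs hC hf ht hw with h | ⟨f', h⟩
    · exact Or.inl h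
    · exact Or.inr ⟨.reedMullerFour, f', h, by decide⟩
  | reedMullerFour => exact Or.inl (reedMuller_absorbs hC hf ht hw)
  | doubledParityCheck k hk =>
    rcases doubledParity_absorbs hC hk hf ht hw with h | ⟨f', h⟩ | ⟨rfl, f', h⟩ | ⟨rfl, f', h⟩
    · exact Or.inl h
    · exact Or.inr ⟨.doubledParityCheck (k + 1) (by omega), f', h, Nat.lt_succ_self k⟩
    · exact Or.inr ⟨.simplexThree, f', h, Nat.lt_succ_self 2⟩
    · exact Or.inr ⟨.reedMullerFour, f', h, Nat.lt_succ_self 3⟩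

instance (b : Block) : Nonempty b.Pos := by
  cases b with
  | simplexThree => exact ⟨⟨1, one_ne_zero⟩⟩
  | reedMullerFour => exact ⟨fun _ => 0⟩
  | doubledParityCheck k hk => exact ⟨(0, 0)⟩

/-- Any pairing of the four positions in the support of `t` works, since `t` is the only nonzero
word required. -/
theorem exists_parityOne_embedsVia {ι : Type} [Fintype ι] {C : BinaryCode ι} {t : ι → ZMod 2}
    (ht : t ∈ C) (hw : hammingNorm t = 4) : ∃ f, (repetition 2 (parityCheck 1)).EmbedsVia f C := by
  classical
  have hcard : Fintype.card (Fin 2 × Fin (1 + 1)) = Fintype.card {i // t i ≠ 0} := by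
    rw [Fintype.card_subtype]
    exact (show Fintype.card (Fin 2 × Fin (1 + 1)) = 4 by simp).trans hw.symm
  let e := Fintype.equivOfCardEq hcard
  have hinj : Function.Injective fun p => (e p).1 := Subtype.val_injective.comp e.injective
  refine ⟨fun p => (e p).1, hinj, fun c hc => ?_⟩
  obtain ⟨d, hd, hc⟩ := mem_repetition_parityCheck.1 hc
  rw [Fin.sum_univ_two] at hd
  have hd' : d 0 = d 1 := CharTwo.add_eq_zero.1 hd
  have hd2 : ∀ i, d i = d 0 := by
    intro i
    fin_cases i
    · rfl
    · exact hd'.symm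
  convert C.smul_mem (d 0) ht
  refine extend_eq_of_comp hinj (fun p => ?_) fun i hi => ?_
  · rw [Pi.smul_apply, zmod_two_ne_zero_iff.1 (e p).2, hc p.1 p.2, hd2 p.2, smul_eq_mul, mul_one]
  · rw [Pi.smul_apply]
    by_cases h : t i = 0
    · rw [h, smul_zero]
    · exact absurd (by simp) (hi (e.symm ⟨i, h⟩))

theorem exists_absorbing_block {ι : Type} [Fintype ι] {C : BinaryCode ι} (hC : C.IsDoublyEven)
    {t : ι → ZMod 2} (ht : t ∈ C) (hw : hammingNorm t = 4) :
    ∃ (b : Block) (f : b.Pos → ι), b.code.EmbedsVia f C ∧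
      ∀ t ∈ C, hammingNorm t = 4 → b.code.Absorbs f t := by
  -- `m` bounds how far the rank can still grow before it reaches the length.
  have key : ∀ (m : ℕ) (b : Block) (f : b.Pos → ι), b.code.EmbedsVia f C →
      Fintype.card ι ≤ b.rank + m → ∃ (b : Block) (f : b.Pos → ι), b.code.EmbedsVia f C ∧
        ∀ t ∈ C, hammingNorm t = 4 → b.code.Absorbs f t := by
    intro m
    induction m with
    | zero =>
      intro b f hf hb
      refine ⟨b, f, hf, fun t ht hw => ?_⟩
      rcases b.absorbs_or_exists_rank_lt hC hf ht hw with h | ⟨b', f', hf', hlt⟩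
      · exact h
      · have h1 := b'.rank_le_card
        have h2 := Fintype.card_le_of_injective f' hf'.1
        omega
    | succ m ih =>
      intro b f hf hb
      by_cases h : ∀ t ∈ C, hammingNorm t = 4 → b.code.Absorbs f t
      · exact ⟨b, f, hf, h⟩
      · push Not at h
        obtain ⟨t, ht, hw, hn⟩ := h
        rcases b.absorbs_or_exists_rank_lt hC hf ht hw with h | ⟨b', f', hf', hlt⟩
        · exact absurd h hn
        · exact ih b' f' hf' (by omega)
  obtain ⟨f, hf⟩ := exists_parityOne_embedsVia ht hw
  exact key _ (.doubledParityCheck 1 le_rfl) f hf (Nat.le_add_left _ _)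

/-! ### Splitting off a block, and existence -/

/-- The words on the positions in the subtype `p` whose extension by zeros lies in `C`. -/
noncomputable def shorten {ι : Type} (C : BinaryCode ι) (p : ι → Prop) : BinaryCode {i // p i} :=
  C.comap (Function.ExtendByZero.linearMap (ZMod 2) Subtype.val)

theorem mem_shorten {ι : Type} {C : BinaryCode ι} {p : ι → Prop} {c : {i // p i} → ZMod 2} :
    c ∈ C.shorten p ↔ Function.extend Subtype.val c 0 ∈ C :=
  Iff.rfl

theorem mem_blockSum {L : List Block} {z : ℕ}
    {c : (Σ j : Fin L.length, (L.get j).Pos) ⊕ Fin z → ZMod 2} :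
    c ∈ blockSum L z ↔ (∀ j, (fun p => c (Sum.inl ⟨j, p⟩)) ∈ (L.get j).code) ∧
      ∀ x, c (Sum.inr x) = 0 :=
  Iff.rfl

theorem isomorphic_blockSum_cons {ι : Type} {C : BinaryCode ι} {b : Block} {f : b.Pos → ι}
    (hf : b.code.EmbedsVia f C)
    (hsplit : ∀ c ∈ C, (fun p => c (f p)) ∈ b.code ∧
      (fun i => c i.1) ∈ C.shorten fun i => ∀ p, f p ≠ i)
    {L : List Block} {z : ℕ}
    (h : Isomorphic (C.shorten fun i => ∀ p, f p ≠ i) (blockSum L z)) :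
    Isomorphic C (blockSum (b :: L) z) := by
  obtain ⟨σ, hσ⟩ := h
  have hmem : ∀ c : ι → ZMod 2, c ∈ C ↔ (fun p => c (f p)) ∈ b.code ∧
      (fun i => c i.1) ∈ C.shorten fun i => ∀ p, f p ≠ i := by
    refine fun c => ⟨hsplit c, fun h => ?_⟩
    convert C.add_mem (hf.2 _ h.1) (mem_shorten.1 h.2)
    funext i
    rw [Pi.add_apply]
    by_cases hi : ∃ p, f p = i
    · obtain ⟨p, rfl⟩ := hi
      rw [hf.1.extend_apply, Function.extend_apply', Pi.zero_apply, add_zero]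
      rintro ⟨⟨j, hj⟩, rfl⟩
      exact hj p rfl
    · rw [Function.extend_apply' _ _ _ hi, Pi.zero_apply, zero_add]
      exact (Subtype.val_injective.extend_apply
        (fun j : {i // ∀ p, f p ≠ i} => c j.1) 0 ⟨i, by simpa using hi⟩).symm
  let g : (j : Fin (b :: L).length) → ((b :: L).get j).Pos → ι :=
    Fin.cases f fun j p => (σ (Sum.inl ⟨j, p⟩)).1
  let τ : (Σ j : Fin (b :: L).length, ((b :: L).get j).Pos) ⊕ Fin z → ι :=
    Sum.elim (fun q => g q.1 q.2) fun x => (σ (Sum.inr x)).1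
  have hinj : Function.Injective τ := by
    rintro (⟨j, p⟩ | x) (⟨l, q⟩ | y) h
    · induction j using Fin.cases with
      | zero =>
        induction l using Fin.cases with
        | zero =>
          have h2 : p = q := hf.1 h
          rw [h2]
        | succ l => exact absurd h ((σ (Sum.inl ⟨l, q⟩)).2 p)
      | succ j =>
        induction l using Fin.cases with
        | zero => exact absurd h.symm ((σ (Sum.inl ⟨j, p⟩)).2 q)
        | succ l =>
          have h2 := σ.injective (Subtype.ext h)
          simp only [Sum.inl.injEq, Sigma.mk.injEq] at h2
          obtain ⟨h3, h4⟩ := h2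
          have h5 : j = l := h3
          subst h5
          rw [eq_of_heq h4]
    · induction j using Fin.cases with
      | zero => exact absurd h ((σ (Sum.inr y)).2 p)
      | succ j => exact absurd (σ.injective (Subtype.ext h)) (by simp)
    · induction l using Fin.cases with
      | zero => exact absurd h.symm ((σ (Sum.inr x)).2 q)
      | succ l => exact absurd (σ.injective (Subtype.ext h)) (by simp)
    · have h2 := σ.injective (Subtype.ext h)
      simp only [Sum.inr.injEq] at h2
      rw [h2]
  have hsurj : Function.Surjective τ := by
    intro i
    by_cases hi : ∃ p, f p = i
    · obtain ⟨p, rfl⟩ := hi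
      exact ⟨Sum.inl ⟨⟨0, Nat.succ_pos _⟩, p⟩, rfl⟩
    · obtain ⟨q, hq⟩ := σ.surjective ⟨i, by simpa using hi⟩
      rcases q with ⟨j, p⟩ | x
      · exact ⟨Sum.inl ⟨j.succ, p⟩, congrArg Subtype.val hq⟩
      · exact ⟨Sum.inr x, congrArg Subtype.val hq⟩
  refine ⟨Equiv.ofBijective τ ⟨hinj, hsurj⟩, fun c => ?_⟩
  rw [hmem, hσ, mem_blockSum, mem_blockSum, ← and_assoc]
  refine and_congr ⟨fun h j => ?_, fun h => ⟨h ⟨0, Nat.succ_pos _⟩, fun j => h j.succ⟩⟩ Iff.rfl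
  induction j using Fin.cases with
  | zero => exact h.1
  | succ j => exact h.2 j

/-- Both conditions are linear in `c`, so the weight-4 generators suffice. The second one names the
span rather than the shortened code, so that it also shows the latter to be spanned by weight 4. -/
theorem split_of_absorbs {ι : Type} [Fintype ι] {C : BinaryCode ι} (hspan : C.IsSpannedByWeight 4)
    {P : Type} {D : BinaryCode P} {f : P → ι} [Fintype {i // ∀ p, f p ≠ i}]
    (ha : ∀ t ∈ C, hammingNorm t = 4 → D.Absorbs f t) {c : ι → ZMod 2} (hc : c ∈ C) :
    (fun p => c (f p)) ∈ D ∧ (fun i => c i.1) ∈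
      Submodule.span (ZMod 2) {u | u ∈ C.shorten (fun i => ∀ p, f p ≠ i) ∧ hammingNorm u = 4} := by
  classical
  rw [← hspan] at hc
  induction hc using Submodule.span_induction with
  | zero => exact ⟨D.zero_mem, Submodule.zero_mem _⟩
  | add x y _ _ hx hy => exact ⟨D.add_mem hx.1 hy.1, Submodule.add_mem _ hx.2 hy.2⟩
  | smul a x _ hx => exact ⟨D.smul_mem a hx.1, Submodule.smul_mem _ a hx.2⟩
  | mem t ht =>
    obtain ⟨ht, hw⟩ := ht
    rcases ha t ht hw with h | ⟨h, h0⟩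
    · have he : Function.extend Subtype.val (fun i : {i // ∀ p, f p ≠ i} => t i.1) 0 = t := by
        refine extend_eq_of_comp Subtype.val_injective (fun _ => rfl) fun i hi => ?_
        by_cases hip : ∃ p, f p = i
        · obtain ⟨p, rfl⟩ := hip
          exact h p
        · exact absurd rfl (hi ⟨i, by simpa using hip⟩)
      refine ⟨by simp only [h]; exact D.zero_mem, Submodule.subset_span ⟨?_, ?_⟩⟩
      · rw [mem_shorten, he]
        exact ht
      · rw [← hammingNorm_extend Subtype.val_injective, he, hw]
    · refine ⟨h, ?_⟩
      have : (fun i : {i // ∀ p, f p ≠ i} => t i.1) = 0 := funext fun i => h0 _ i.2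
      rw [this]
      exact Submodule.zero_mem _

theorem isomorphic_blockSum_nil {ι : Type} [Fintype ι] :
    Isomorphic (⊥ : BinaryCode ι) (blockSum [] (Fintype.card ι)) := by
  have : IsEmpty (Σ j : Fin ([] : List Block).length, (([] : List Block).get j).Pos) :=
    ⟨fun x => x.1.elim0⟩
  refine ⟨(Equiv.emptySum _ _).trans (Fintype.equivFin ι).symm, fun c => ?_⟩
  rw [mem_blockSum, Submodule.mem_bot]
  constructor
  · rintro rfl
    exact ⟨fun j => j.elim0, fun _ => rfl⟩
  · rintro ⟨-, h⟩
    funext i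
    simpa using h (Fintype.equivFin ι i)

theorem exists_isomorphic_blockSum {ι : Type} [Fintype ι] (C : BinaryCode ι)
    (hC : C.IsDoublyEven) (hspan : C.IsSpannedByWeight 4) :
    ∃ (L : List Block) (z : ℕ), Isomorphic C (blockSum L z) := by
  classical
  induction hn : Fintype.card ι using Nat.strong_induction_on generalizing ι with
  | _ n ih =>
    by_cases ht : ∃ t ∈ C, hammingNorm t = 4
    · obtain ⟨t, ht, hw⟩ := ht
      obtain ⟨b, f, hf, ha⟩ := exists_absorbing_block hC ht hw
      have hle : Submodule.span (ZMod 2)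
          {u | u ∈ C.shorten (fun i => ∀ p, f p ≠ i) ∧ hammingNorm u = 4} ≤
            C.shorten fun i => ∀ p, f p ≠ i :=
        Submodule.span_le.2 fun u hu => hu.1
      -- A block has at least one position, so the shortened code is strictly shorter.
      obtain ⟨p⟩ := (inferInstance : Nonempty b.Pos)
      obtain ⟨L, z, h⟩ := ih (Fintype.card {i // ∀ p, f p ≠ i})
        (hn ▸ Fintype.card_subtype_lt (x := f p) fun h => h p rfl)
        (C.shorten fun i => ∀ p, f p ≠ i)
        (fun c hc => by
          rw [← hammingNorm_extend Subtype.val_injective]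
          exact hC _ (mem_shorten.1 hc))
        (le_antisymm hle fun c hc => by
          have := (split_of_absorbs hspan ha (mem_shorten.1 hc)).2
          simpa only [Subtype.val_injective.extend_apply] using this) rfl
      refine ⟨b :: L, z, isomorphic_blockSum_cons hf (fun c hc => ?_) h⟩
      have := split_of_absorbs hspan ha hc
      exact ⟨this.1, hle this.2⟩
    · have hbot : C = ⊥ := by
        rw [← hspan, Submodule.span_eq_bot]
        intro t h
        exact absurd ⟨t, h⟩ ht
      subst hbot
      exact ⟨[], _, isomorphic_blockSum_nil⟩

/-! ### Invariants of positions -/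

/-- Some nonzero codeword of minimal support is nonzero at both positions `i` and `j`. -/
def Linked {ι : Type} (C : BinaryCode ι) (i j : ι) : Prop :=
  ∃ c ∈ C, c i ≠ 0 ∧ c j ≠ 0 ∧ ∀ d ∈ C, (∀ r, c r = 0 → d r = 0) → d = 0 ∨ d = c

/-- Some other position linked to `i` carries the same column as `i`. -/
def HasTwin {ι : Type} (C : BinaryCode ι) (i : ι) : Prop :=
  ∃ j, j ≠ i ∧ C.Linked i j ∧ ∀ c ∈ C, c i = c j

/-- The number of positions linked to `i`, and whether `i` has a twin. -/
noncomputable def key {ι : Type} (C : BinaryCode ι) (i : ι) : ℕ × Prop :=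
  (Nat.card {j // C.Linked i j}, C.HasTwin i)

/-- The key of every position of the given building block. -/
def Block.key : Block → ℕ × Prop
  | .simplexThree => (7, False)
  | .reedMullerFour => (8, False)
  | .doubledParityCheck k _ => (2 * (k + 1), True)

/-- Length alone does not suffice: the Reed–Muller code and the doubled parity check code with `k =
3` both have length 8, and the twin flag separates them. -/
theorem Block.key_injective : Function.Injective Block.key := by
  intro b b' h
  cases b <;> cases b' <;> simp [Block.key] at h ⊢
  exact h

section Isomorphism

variable {ι κ : Type} {C : BinaryCode ι} {D : BinaryCode κ} {σ : κ ≃ ι}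

theorem comp_symm_mem (hσ : ∀ c : ι → ZMod 2, c ∈ C ↔ c ∘ σ ∈ D) {d : κ → ZMod 2} :
    d ∘ σ.symm ∈ C ↔ d ∈ D := by
  rw [hσ, Function.comp_assoc, σ.symm_comp_self, Function.comp_id]

theorem linked_iff_of_isomorphism (hσ : ∀ c : ι → ZMod 2, c ∈ C ↔ c ∘ σ ∈ D) (p q : κ) :
    C.Linked (σ p) (σ q) ↔ D.Linked p q := by
  constructor
  · rintro ⟨c, hc, hp, hq, h⟩
    refine ⟨c ∘ σ, (hσ c).1 hc, hp, hq, fun d hd hr => ?_⟩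
    rcases h (d ∘ σ.symm) ((comp_symm_mem hσ).2 hd)
      (fun r hr0 => hr _ (by simpa using hr0)) with h0 | h0
    · left
      funext k
      simpa using congrFun h0 (σ k)
    · right
      funext k
      simpa using congrFun h0 (σ k)
  · rintro ⟨c, hc, hp, hq, h⟩
    refine ⟨c ∘ σ.symm, (comp_symm_mem hσ).2 hc, by simpa using hp, by simpa using hq,
      fun d hd hr => ?_⟩
    rcases h (d ∘ σ) ((hσ d).1 hd) (fun r hr0 => hr _ (by simpa using hr0)) with h0 | h0
    · left
      funext i
      simpa using congrFun h0 (σ.symm i)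
    · right
      funext i
      simpa using congrFun h0 (σ.symm i)

theorem key_of_isomorphism (hσ : ∀ c : ι → ZMod 2, c ∈ C ↔ c ∘ σ ∈ D) (p : κ) :
    C.key (σ p) = D.key p := by
  unfold key
  rw [Prod.mk.injEq]
  constructor
  · exact (Nat.card_congr (σ.subtypeEquiv fun q => (linked_iff_of_isomorphism hσ p q).symm)).symm
  · refine propext ⟨?_, ?_⟩
    · rintro ⟨i, hi, hl, h⟩
      obtain ⟨q, rfl⟩ := σ.surjective i
      refine ⟨q, fun e => hi (by rw [e]), (linked_iff_of_isomorphism hσ p q).1 hl, fun d hd => ?_⟩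
      simpa using h _ ((comp_symm_mem hσ).2 hd)
    · rintro ⟨q, hq, hl, h⟩
      exact ⟨σ q, fun e => hq (σ.injective e), (linked_iff_of_isomorphism hσ p q).2 hl,
        fun c hc => h _ ((hσ c).1 hc)⟩

end Isomorphism

/-- The minimal words used are those of weight 4: nonconstant affine or linear functions, or two
full pairs. -/
theorem Block.linked (b : Block) (p q : b.Pos) : b.code.Linked p q := by
  cases b with
  | simplexThree =>
    obtain ⟨p, hp⟩ := p
    obtain ⟨q, hq⟩ := q
    rcases exists_linear_ne_zero p q with h | h | ⟨a, h1, h2⟩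
    · exact absurd h hp
    · exact absurd h hq
    · refine ⟨fun v => ∑ i, a i * v.1 i, mem_simplex.2 ⟨a, fun _ => rfl⟩, h1, h2, ?_⟩
      intro d hd hr
      obtain ⟨a', hd⟩ := mem_simplex.1 hd
      rcases linear_minimal a a' (fun v hv h => (hd ⟨v, hv⟩).symm.trans (hr ⟨v, hv⟩ h))
        with rfl | rfl
      · left
        funext v
        simpa using hd v
      · right
        exact funext hd
  | reedMullerFour =>
    obtain ⟨a, ha, β, h1, h2⟩ := exists_affine_ne_zero p q
    refine ⟨fun v => β + ∑ i, a i * v i, mem_firstOrderReedMuller.2 ⟨β, a, fun _ => rfl⟩,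
      h1, h2, ?_⟩
    intro d hd hr
    obtain ⟨β', a', hd⟩ := mem_firstOrderReedMuller.1 hd
    rcases affine_minimal a a' ha β β' (fun v h => (hd v).symm.trans (hr v h))
      with ⟨rfl, rfl⟩ | ⟨rfl, rfl⟩
    · left
      funext v
      simpa using hd v
    · right
      exact funext hd
  | doubledParityCheck k hk =>
    obtain ⟨x, i⟩ := p
    obtain ⟨y, j⟩ := q
    have hl : ∀ l, i ≠ l → ∃ c ∈ repetition 2 (parityCheck k),
        (∀ x, c (x, i) = 1) ∧ (∀ x, c (x, l) = 1) ∧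
        ∀ d ∈ repetition 2 (parityCheck k), (∀ r, c r = 0 → d r = 0) → d = 0 ∨ d = c := by
      intro l hil
      refine ⟨fun r => (Pi.single i 1 + Pi.single l 1 : Fin (k + 1) → ZMod 2) r.2,
        mem_repetition_parityCheck.2 ⟨_, ?_, fun _ _ => rfl⟩, ?_, ?_, ?_⟩
      · simp [Finset.sum_add_distrib, CharTwo.add_self_eq_zero]
      · simp [hil]
      · simp [hil.symm]
      · intro d hd hr
        obtain ⟨e, he, hd⟩ := mem_repetition_parityCheck.1 hd
        have h0 : ∀ m, m ≠ i → m ≠ l → e m = 0 := fun m hmi hml => by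
          rw [← hd 0 m]
          exact hr (0, m) (by simp [hmi, hml])
        have hes : e = fun m => e i * (Pi.single i 1 : Fin (k + 1) → ZMod 2) m +
            e l * (Pi.single l 1 : Fin (k + 1) → ZMod 2) m := by
          funext m
          by_cases hmi : m = i
          · subst hmi
            simp [hil]
          · by_cases hml : m = l
            · subst hml
              simp [hmi]
            · simp [hmi, hml, h0 m hmi hml]
        have hel : e i + e l = 0 := by
          rw [hes] at he
          simpa [Finset.sum_add_distrib, ← Finset.mul_sum] using he
        rw [← CharTwo.add_eq_zero.1 hel] at hes
        rcases zmod_two_eq_zero_or_one (e i) with h | h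
        · left
          funext r
          rw [hd r.1 r.2, hes, h]
          simp
        · right
          funext r
          rw [hd r.1 r.2, hes, h]
          simp
    -- Within one pair, any other pair completes the word; it exists because `k ≥ 1`.
    by_cases hij : i = j
    · subst hij
      have : Nontrivial (Fin (k + 1)) := Fin.nontrivial_iff_two_le.2 (by omega)
      obtain ⟨l, hl'⟩ := exists_ne i
      obtain ⟨c, hc, h1, -, h3⟩ := hl l hl'.symm
      exact ⟨c, hc, by simp [h1], by simp [h1], h3⟩
    · obtain ⟨c, hc, h1, h2, h3⟩ := hl j hij
      exact ⟨c, hc, by simp [h1], by simp [h2], h3⟩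

theorem Block.hasTwin_iff (b : Block) (p : b.Pos) : b.code.HasTwin p ↔ b.key.2 := by
  have hsep : ∀ v w : Fin 3 → ZMod 2, (∀ i, v i = w i) → w = v := fun v w h => (funext h).symm
  cases b with
  | simplexThree =>
    refine iff_of_false ?_ not_false
    rintro ⟨q, hq, -, h⟩
    refine hq (Subtype.ext (hsep _ _ fun i => ?_))
    exact h (fun v => v.1 i) (mem_simplex.2 ⟨Pi.single i 1, fun v => by simp [Pi.single_apply]⟩)
  | reedMullerFour =>
    refine iff_of_false ?_ not_false
    rintro ⟨q, hq, -, h⟩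
    refine hq (hsep _ _ fun i => ?_)
    exact h (fun v => v i)
      (mem_firstOrderReedMuller.2 ⟨0, Pi.single i 1, fun v => by simp [Pi.single_apply]⟩)
  | doubledParityCheck k hk =>
    refine iff_of_true ?_ trivial
    obtain ⟨x, i⟩ := p
    refine ⟨(x + 1, i), fun h => ?_, Block.linked (.doubledParityCheck k hk) _ _, fun c hc => ?_⟩
    · have h2 : x + 1 = x := congrArg Prod.fst h
      revert h2
      clear * -
      revert x
      decide
    · obtain ⟨d, -, hd⟩ := mem_repetition_parityCheck.1 hc
      rw [hd, hd]

theorem Block.card_pos (b : Block) : Nat.card b.Pos = b.key.1 := by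
  cases b with
  | simplexThree =>
    change Nat.card {v : Fin 3 → ZMod 2 // v ≠ 0} = 7
    rw [Nat.card_eq_fintype_card, Fintype.card_subtype_compl]
    simp
  | reedMullerFour =>
    change Nat.card (Fin 3 → ZMod 2) = 8
    simp
  | doubledParityCheck k hk =>
    change Nat.card (Fin 2 × Fin (k + 1)) = 2 * (k + 1)
    simp

/-! ### Linked positions and keys in a direct sum -/

section BlockSum

variable {L : List Block} {z : ℕ}

/-- The part of the word `c` in the `j`-th block. -/
def blockPart (j : Fin L.length)
    (c : (Σ j : Fin L.length, (L.get j).Pos) ⊕ Fin z → ZMod 2) :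
    (Σ j : Fin L.length, (L.get j).Pos) ⊕ Fin z → ZMod 2 :=
  Sum.elim (fun q => if q.1 = j then c (Sum.inl q) else 0) fun _ => 0

theorem blockPart_mem (j : Fin L.length)
    {c : (Σ j : Fin L.length, (L.get j).Pos) ⊕ Fin z → ZMod 2} (hc : c ∈ blockSum L z) :
    blockPart j c ∈ blockSum L z := by
  refine mem_blockSum.2 ⟨fun l => ?_, fun _ => rfl⟩
  by_cases h : l = j
  · simpa [blockPart, h] using (mem_blockSum.1 hc).1 l
  · simp only [blockPart, Sum.elim_inl, if_neg h]
    exact (L.get l).code.zero_mem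

/-- The word that is `c` in the `j`-th block and zero elsewhere. -/
noncomputable def blockWord (z : ℕ) (j : Fin L.length) (c : (L.get j).Pos → ZMod 2) :
    (Σ j : Fin L.length, (L.get j).Pos) ⊕ Fin z → ZMod 2 :=
  Function.extend (fun p => Sum.inl ⟨j, p⟩) c 0

theorem blockInl_injective (j : Fin L.length) : Function.Injective
    fun p => (Sum.inl ⟨j, p⟩ : (Σ j : Fin L.length, (L.get j).Pos) ⊕ Fin z) := by
  intro p q h
  simpa using h

theorem blockWord_apply (j : Fin L.length) (c : (L.get j).Pos → ZMod 2) (p : (L.get j).Pos) :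
    blockWord z j c (Sum.inl ⟨j, p⟩) = c p :=
  (blockInl_injective j).extend_apply _ _ p

theorem blockWord_apply_of_ne (j : Fin L.length) (c : (L.get j).Pos → ZMod 2)
    {r : (Σ j : Fin L.length, (L.get j).Pos) ⊕ Fin z} (hr : ∀ p, r ≠ Sum.inl ⟨j, p⟩) :
    blockWord z j c r = 0 := by
  refine Function.extend_apply' _ _ _ ?_
  rintro ⟨p, rfl⟩
  exact hr p rfl

theorem blockWord_mem (j : Fin L.length) {c : (L.get j).Pos → ZMod 2} (hc : c ∈ (L.get j).code) :
    blockWord z j c ∈ blockSum L z := by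
  refine mem_blockSum.2 ⟨fun l => ?_, fun x => blockWord_apply_of_ne j c (by simp)⟩
  by_cases h : l = j
  · subst h
    simpa only [blockWord_apply] using hc
  · have : (fun p => blockWord z j c (Sum.inl ⟨l, p⟩)) = 0 := by
      funext p
      refine blockWord_apply_of_ne j c fun q hq => h ?_
      simp only [Sum.inl.injEq, Sigma.mk.injEq] at hq
      exact hq.1
    rw [this]
    exact (L.get l).code.zero_mem

theorem blockSum_linked_inl (j : Fin L.length) (p q : (L.get j).Pos) :
    (blockSum L z).Linked (Sum.inl ⟨j, p⟩) (Sum.inl ⟨j, q⟩) := by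
  obtain ⟨c, hc, hp, hq, h⟩ := (L.get j).linked p q
  refine ⟨blockWord z j c, blockWord_mem j hc, by rwa [blockWord_apply], by rwa [blockWord_apply],
    fun d hd hr => ?_⟩
  have hd0 : ∀ r, (∀ p, r ≠ Sum.inl ⟨j, p⟩) → d r = 0 := fun r hr' =>
    hr r (blockWord_apply_of_ne j c hr')
  have hdw : d = blockWord z j fun p => d (Sum.inl ⟨j, p⟩) := by
    refine (extend_eq_of_comp (blockInl_injective j) (fun _ => rfl) fun r hr' => hd0 r ?_).symm
    exact fun p => (hr' p).symm
  rcases h _ ((mem_blockSum.1 hd).1 j) (fun r hr0 => hr _ (by rwa [blockWord_apply])) with h0 | h0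
  · left
    rw [hdw, h0]
    funext r
    by_cases hr' : ∀ p, r ≠ Sum.inl ⟨j, p⟩
    · exact blockWord_apply_of_ne j _ hr'
    · push Not at hr'
      obtain ⟨p, rfl⟩ := hr'
      exact blockWord_apply j _ p
  · right
    rw [hdw, h0]

/-- The part in block `j` of a minimal word is a codeword with smaller or equal support. It is
nonzero at `p`, so it is the whole word, and minimal words do not cross blocks. -/
theorem blockSum_linked_inl_iff (j : Fin L.length) (p : (L.get j).Pos)
    (r : (Σ j : Fin L.length, (L.get j).Pos) ⊕ Fin z) :
    (blockSum L z).Linked (Sum.inl ⟨j, p⟩) r ↔ ∃ q, r = Sum.inl ⟨j, q⟩ := by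
  constructor
  · rintro ⟨c, hc, hp, hr, h⟩
    rcases h _ (blockPart_mem j hc) (by rintro (r | r) hr <;> simp [blockPart, hr]) with h0 | h0
    · exact absurd (congrFun h0 (Sum.inl ⟨j, p⟩)) (by simpa [blockPart] using hp)
    · rcases r with ⟨l, q⟩ | x
      · by_cases hl : l = j
        · subst hl
          exact ⟨q, rfl⟩
        · exact absurd (congrFun h0 (Sum.inl ⟨l, q⟩)).symm (by simpa [blockPart, hl] using hr)
      · exact absurd ((mem_blockSum.1 hc).2 x) hr
  · rintro ⟨q, rfl⟩
    exact blockSum_linked_inl j p q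

theorem blockSum_key_inl (j : Fin L.length) (p : (L.get j).Pos) :
    (blockSum L z).key (Sum.inl ⟨j, p⟩) = (L.get j).key := by
  refine Prod.ext ?_ (propext ?_)
  · rw [← Block.card_pos]
    symm
    refine Nat.card_congr (Equiv.ofBijective
      (fun q => ⟨Sum.inl ⟨j, q⟩, blockSum_linked_inl j p q⟩) ⟨fun q r h => ?_, ?_⟩)
    · exact blockInl_injective j (congrArg Subtype.val h)
    · rintro ⟨r, hr⟩
      obtain ⟨q, rfl⟩ := (blockSum_linked_inl_iff j p r).1 hr
      exact ⟨q, rfl⟩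
  · rw [← Block.hasTwin_iff _ p]
    constructor
    · rintro ⟨r, hne, hl, h⟩
      obtain ⟨q, rfl⟩ := (blockSum_linked_inl_iff j p r).1 hl
      refine ⟨q, fun hq => hne (by rw [hq]), Block.linked _ _ _, fun c hc => ?_⟩
      simpa only [blockWord_apply] using h _ (blockWord_mem (z := z) j hc)
    · rintro ⟨q, hne, -, h⟩
      exact ⟨Sum.inl ⟨j, q⟩, fun hq => hne (blockInl_injective j hq), blockSum_linked_inl j p q,
        fun c hc => h _ ((mem_blockSum.1 hc).1 j)⟩

theorem blockSum_key_inr (x : Fin z) : (blockSum L z).key (Sum.inr x) = (0, False) := by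
  have h : ∀ r, ¬(blockSum L z).Linked (Sum.inr x) r := by
    rintro r ⟨c, hc, h, -⟩
    exact h ((mem_blockSum.1 hc).2 x)
  refine Prod.ext ?_ (propext (iff_of_false ?_ not_false))
  · have : IsEmpty {r // (blockSum L z).Linked (Sum.inr x) r} := ⟨fun r => h _ r.2⟩
    exact Nat.card_of_isEmpty
  · rintro ⟨r, -, hl, -⟩
    exact h r hl

end BlockSum

/-! ### Counting positions by key, and uniqueness -/

theorem card_key_eq_of_isomorphism {ι κ : Type} {C : BinaryCode ι} {D : BinaryCode κ}
    (h : Isomorphic C D) (v : ℕ × Prop) :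
    Nat.card {i // C.key i = v} = Nat.card {p // D.key p = v} := by
  obtain ⟨σ, hσ⟩ := h
  exact (Nat.card_congr (σ.subtypeEquiv fun p => by rw [key_of_isomorphism hσ])).symm

theorem Block.key_ne_zero (b : Block) : b.key ≠ (0, False) := by
  cases b <;> simp [Block.key]

theorem card_blockSum_key_eq (L : List Block) (z : ℕ) (v : ℕ × Prop) [DecidablePred (· = v)] :
    Nat.card {p // (blockSum L z).key p = v} =
      (L.map fun b => if b.key = v then b.key.1 else 0).sum + if (0, False) = v then z else 0 := by
  classical
  have e : {p // (blockSum L z).key p = v} ≃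
      (Σ j : Fin L.length, {p : (L.get j).Pos // (L.get j).key = v}) ⊕
        {x : Fin z // ((0, False) : ℕ × Prop) = v} :=
    Equiv.trans Equiv.subtypeSum (Equiv.sumCongr
      { toFun := fun q => ⟨q.1.1, q.1.2, by rw [← blockSum_key_inl (z := z) q.1.1 q.1.2]; exact q.2⟩
        invFun := fun q => ⟨⟨q.1, q.2.1⟩, by rw [blockSum_key_inl]; exact q.2.2⟩
        left_inv := fun _ => rfl
        right_inv := fun _ => rfl }
      (Equiv.subtypeEquivRight fun x => by rw [blockSum_key_inr]))
  rw [Nat.card_congr e, Nat.card_sum, Nat.card_sigma]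
  congr 1
  · rw [← Fin.sum_univ_fun_getElem L fun b => if b.key = v then b.key.1 else 0]
    refine Finset.sum_congr rfl fun j _ => ?_
    by_cases h : (L.get j).key = v
    · rw [Nat.card_congr (Equiv.subtypeUnivEquiv fun _ => h), Block.card_pos]
      exact (if_pos h).symm
    · have : IsEmpty {p : (L.get j).Pos // (L.get j).key = v} := ⟨fun p => h p.2⟩
      rw [Nat.card_of_isEmpty]
      exact (if_neg h).symm
  · split_ifs with h
    · rw [Nat.card_congr (Equiv.subtypeUnivEquiv fun _ => h), Nat.card_fin]
    · have : IsEmpty {x : Fin z // ((0, False) : ℕ × Prop) = v} := ⟨fun p => h p.2⟩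
      exact Nat.card_of_isEmpty

/-- Since keys are injective, only copies of `b` contribute, each with its full length. Dividing by
this positive length recovers the multiplicity. -/
theorem card_blockSum_key_eq_block [DecidableEq Block] (L : List Block) (z : ℕ) (b : Block) :
    Nat.card {p // (blockSum L z).key p = b.key} = L.count b * b.key.1 := by
  classical
  rw [card_blockSum_key_eq, if_neg b.key_ne_zero.symm, add_zero]
  induction L with
  | nil => simp
  | cons a L ih =>
    rw [List.map_cons, List.sum_cons, ih, List.count_cons]
    by_cases h : a = b
    · subst h
      simp [add_mul, add_comm]
    · simp [h, Block.key_injective.ne h]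

theorem card_blockSum_key_eq_zero (L : List Block) (z : ℕ) :
    Nat.card {p // (blockSum L z).key p = (0, False)} = z := by
  classical
  rw [card_blockSum_key_eq, if_pos rfl, Nat.add_eq_right]
  refine List.sum_eq_zero fun x hx => ?_
  obtain ⟨b, -, rfl⟩ := List.mem_map.1 hx
  exact if_neg b.key_ne_zero

theorem blockSum_unique {ι : Type} {C : BinaryCode ι} {L L' : List Block} {z z' : ℕ}
    (h : Isomorphic C (blockSum L z)) (h' : Isomorphic C (blockSum L' z')) :
    L'.Perm L ∧ z' = z := by
  classical
  constructor
  · rw [List.perm_iff_count]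
    intro b
    have hb := (card_key_eq_of_isomorphism h' b.key).symm.trans (card_key_eq_of_isomorphism h b.key)
    rw [card_blockSum_key_eq_block, card_blockSum_key_eq_block] at hb
    refine Nat.eq_of_mul_eq_mul_right ?_ hb
    rw [← Block.card_pos]
    exact Nat.card_pos
  · have hz := (card_key_eq_of_isomorphism h' (0, False)).symm.trans
      (card_key_eq_of_isomorphism h (0, False))
    rwa [card_blockSum_key_eq_zero, card_blockSum_key_eq_zero] at hz

end BinaryCode

theorem mainTheorem6 (n : ℕ) (C : BinaryCode (Fin n)) (heven : C.IsDoublyEven)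
    (hspan : C.IsSpannedByWeight 4) :
    ∃ (L : List BinaryCode.Block) (z : ℕ),
      BinaryCode.Isomorphic C (BinaryCode.blockSum L z) ∧
      ∀ (L' : List BinaryCode.Block) (z' : ℕ),
        BinaryCode.Isomorphic C (BinaryCode.blockSum L' z') → L'.Perm L ∧ z' = z := by
  obtain ⟨L, z, h⟩ := BinaryCode.exists_isomorphic_blockSum C heven hspan
  exact ⟨L, z, h, fun _ _ h' => BinaryCode.blockSum_unique h h'⟩
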